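/- Let $(a_n)_{n\in\mathbb N}$ be a discrete sequence in $\mathbb R^d$, i.e. a map $\mathbb N\to\mathbb R^d$ whose image has no limit point in $\mathbb R^d$ and which takes each value at most finitely many times. Then $(a_n)$ is uniformly spread over $\mathbb R^d$, in the sense that there is $\alpha>0$ such that $$\inf_\psi\ \sup_n\,|a_n-\alpha\psi(n)|<\infty,$$ where the infimum is taken over all bijections $\psi:\mathbb N\to\mathbb Z^d$, if and only if there is a constant $C<\infty$ such that for every $z\in\mathbb R^d$ there is a bijection $\sigma:\mathbb N\to\mathbb N$ with $$\sup_n\,|a_n+z-a_{\sigma(n)}|\le C .$$ -/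

import Mathlib

open scoped ENNReal

/-- A discrete sequence in `ℝ^d`: its image has no limit point in `ℝ^d`, and each value is taken
only finitely many times. -/
def IsDiscreteSeq {d : ℕ} (a : ℕ → EuclideanSpace ℝ (Fin d)) : Prop :=
  (∀ x : EuclideanSpace ℝ (Fin d), ¬ AccPt x (Filter.principal (Set.range a))) ∧
    ∀ x ∈ Set.range a, {n : ℕ | a n = x}.Finite

/-- The point of `ℝ^d` with the integer coordinates `m`. -/
noncomputable def latticePoint {d : ℕ} (m : Fin d → ℤ) : EuclideanSpace ℝ (Fin d) :=
  WithLp.toLp 2 (fun j => (m j : ℝ))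

/-- The sequence `a` is uniformly spread over `ℝ^d`: for some `α > 0`, the infimum over all
bijections `ψ : ℕ → ℤ^d` of `sup_n |a_n - α ψ(n)|`, taken in `[0, ∞]`, is finite. -/
def IsUniformlySpread {d : ℕ} (a : ℕ → EuclideanSpace ℝ (Fin d)) : Prop :=
  ∃ α : ℝ, 0 < α ∧
    (⨅ ψ : ℕ ≃ (Fin d → ℤ), ⨆ n : ℕ, edist (a n) (α • latticePoint (ψ n))) < (∞ : ℝ≥0∞)

/-! A uniformly spread sequence inherits the translations of its lattice: round `z` down to a
lattice vector and conjugate that shift by `ψ`. Conversely, almost invariance makes cube counts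
nearly independent of position, giving a density `c > 0`; take `α` with `c * α ^ d = 1`. Translating
by `z` compares a finite set of terms with the cells `α b + z + [0, α)^d` of its neighbouring
lattice points `b`. Averaging over many `z` replaces cells by large cubes, whose counts `c`
controls, and yields Hall's condition in both directions (`card_le_card_nearLattice`,
`card_nearLattice_le_card`). Schröder–Bernstein merges the two matchings. -/

/-- The number of indices `n` with `p n` in the half-open cube `x + [0, L)^d`. -/
noncomputable def cubeCount {d : ℕ} (p : ℕ → Fin d → ℝ) (x : Fin d → ℝ) (L : ℝ) : ℕ :=
  {n : ℕ | ∀ j, x j ≤ p n j ∧ p n j < x j + L}.ncard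

/-- Every cube contains only finitely many terms of `p`. -/
def LocallyFiniteSeq {d : ℕ} (p : ℕ → Fin d → ℝ) : Prop :=
  ∀ (x : Fin d → ℝ) (L : ℝ), {n : ℕ | ∀ j, x j ≤ p n j ∧ p n j < x j + L}.Finite

/-- Every translate of `p` is a permutation of `p` up to an error at most `C` per coordinate. -/
def AlmostInvariant {d : ℕ} (p : ℕ → Fin d → ℝ) (C : ℝ) : Prop :=
  ∀ z : Fin d → ℝ, ∃ σ : ℕ ≃ ℕ, ∀ n j, |p n j + z j - p (σ n) j| ≤ C

/-! ### Cube counts and density -/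

section Count

variable {d : ℕ} {p : ℕ → Fin d → ℝ} {C : ℝ}

/-- Translate the first cube to `y + C + [0, L)^d`; the error of at most `C` per coordinate keeps
its terms in `y + [0, L + 2C)^d`. -/
lemma cubeCount_le_of_almostInvariant (hf : LocallyFiniteSeq p) (hC : AlmostInvariant p C)
    (x y : Fin d → ℝ) {L L' : ℝ} (hL : L + 2 * C ≤ L') : cubeCount p x L ≤ cubeCount p y L' := by
  obtain ⟨σ, hσ⟩ := hC (fun j => y j + C - x j)
  refine Set.ncard_le_ncard_of_injOn σ ?_ σ.injective.injOn (hf y L')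
  intro n hn j
  have h := abs_le.1 (hσ n j)
  have h' := hn j
  constructor <;> linarith

lemma cubeCount_mono (hf : LocallyFiniteSeq p) (x : Fin d → ℝ) {L L' : ℝ} (h : L ≤ L') :
    cubeCount p x L ≤ cubeCount p x L' := by
  refine Set.ncard_le_ncard ?_ (hf x L')
  intro n hn j
  exact ⟨(hn j).1, (hn j).2.trans_le (by linarith)⟩

lemma one_le_cubeCount (hf : LocallyFiniteSeq p) (n : ℕ) {L : ℝ} (hL : 0 < L) :
    1 ≤ cubeCount p (p n) L :=
  (Set.ncard_pos (hf _ _)).2 ⟨n, fun j => ⟨le_rfl, by linarith⟩⟩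

lemma mem_subcube_iff {L : ℝ} (hL : 0 < L) (x t : ℝ) (i : ℤ) :
    (x + L * i ≤ t ∧ t < x + L * i + L) ↔ ⌊(t - x) / L⌋ = i := by
  rw [Int.floor_eq_iff, le_div_iff₀ hL, div_lt_iff₀ hL]
  constructor <;> rintro ⟨h1, h2⟩ <;> constructor <;> linarith

lemma cubeCount_mul (hf : LocallyFiniteSeq p) (x : Fin d → ℝ) {L : ℝ} (hL : 0 < L) (k : ℕ) :
    cubeCount p x (k * L) =
      ∑ i : Fin d → Fin k, cubeCount p (fun j => x j + L * ((i j : ℕ) : ℝ)) L := by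
  classical
  have key : (hf x (k * L)).toFinset =
      Finset.univ.biUnion
        (fun i : Fin d → Fin k => (hf (fun j => x j + L * ((i j : ℕ) : ℝ)) L).toFinset) := by
    ext n
    simp only [Set.Finite.mem_toFinset, Set.mem_ofPred_eq, Finset.mem_biUnion, Finset.mem_univ,
      true_and]
    constructor
    · intro h
      have h0 : ∀ j, 0 ≤ ⌊(p n j - x j) / L⌋ := fun j =>
        Int.floor_nonneg.2 (div_nonneg (by linarith [(h j).1]) hL.le)
      have h1 : ∀ j, ⌊(p n j - x j) / L⌋ < k := fun j => by
        rw [Int.floor_lt, div_lt_iff₀ hL]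
        have := (h j).2
        push_cast
        linarith
      refine ⟨fun j => ⟨⌊(p n j - x j) / L⌋.toNat, by have := h0 j; have := h1 j; omega⟩, ?_⟩
      intro j
      have e : ((⌊(p n j - x j) / L⌋.toNat : ℕ) : ℝ) = (⌊(p n j - x j) / L⌋ : ℝ) := by
        rw [← Int.cast_natCast, Int.toNat_of_nonneg (h0 j)]
      have := (mem_subcube_iff hL (x j) (p n j) ⌊(p n j - x j) / L⌋).2 rfl
      rwa [← e] at this
    · rintro ⟨i, hi⟩ j
      have h1 : ((i j : ℕ) : ℝ) + 1 ≤ k := by exact_mod_cast (i j).2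
      have h2 : (0 : ℝ) ≤ ((i j : ℕ) : ℝ) := Nat.cast_nonneg _
      have := hi j
      constructor <;> nlinarith
  have hd : ((Finset.univ : Finset (Fin d → Fin k)) : Set (Fin d → Fin k)).PairwiseDisjoint
      (fun i : Fin d → Fin k => (hf (fun j => x j + L * ((i j : ℕ) : ℝ)) L).toFinset) := by
    intro i _ i' _ hne
    refine Finset.disjoint_left.2 fun n hn hn' => hne ?_
    simp only [Set.Finite.mem_toFinset, Set.mem_ofPred_eq] at hn hn'
    ext j
    have e1 := (mem_subcube_iff hL (x j) (p n j) (i j : ℕ)).1 (by simpa using hn j)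
    have e2 := (mem_subcube_iff hL (x j) (p n j) (i' j : ℕ)).1 (by simpa using hn' j)
    omega
  unfold cubeCount
  rw [Set.ncard_eq_toFinset_card _ (hf _ _), key, Finset.card_biUnion hd]
  exact Finset.sum_congr rfl fun i _ => (Set.ncard_eq_toFinset_card _ (hf _ _)).symm

lemma cubeCount_mul_le (hf : LocallyFiniteSeq p) (hC : AlmostInvariant p C) {L : ℝ} (hL : 0 < L)
    (k : ℕ) (x : Fin d → ℝ) :
    cubeCount p x (k * L) ≤ k ^ d * cubeCount p 0 (L + 2 * C) := by
  rw [cubeCount_mul hf x hL]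
  refine (Finset.sum_le_card_nsmul _ _ _ fun i _ =>
    cubeCount_le_of_almostInvariant hf hC _ 0 le_rfl).trans ?_
  simp

/-- The number of terms of `p` in a cube of side `T`, compared with that for a fixed side. -/
lemma cubeCount_le_div_pow (hf : LocallyFiniteSeq p) (hC : AlmostInvariant p C) {L T : ℝ}
    (hL : 0 < L) (hT : 0 ≤ T) (x : Fin d → ℝ) :
    (cubeCount p x T : ℝ) ≤ (T / L + 1) ^ d * cubeCount p 0 (L + 2 * C) := by
  have h1 : T ≤ (⌈T / L⌉₊ : ℝ) * L := (div_le_iff₀ hL).1 (Nat.le_ceil _)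
  have h2 : (cubeCount p x T : ℝ) ≤ (⌈T / L⌉₊ : ℝ) ^ d * cubeCount p 0 (L + 2 * C) := by
    exact_mod_cast (cubeCount_mono hf x h1).trans (cubeCount_mul_le hf hC hL _ x)
  refine h2.trans ?_
  gcongr
  exact (Nat.ceil_lt_add_one (by positivity)).le

/-- Large cubes contain at least a fixed proportion of terms of `p`. -/
lemma exists_pos_mul_pow_le_cubeCount (hf : LocallyFiniteSeq p) (hC : AlmostInvariant p C)
    (hC0 : 0 ≤ C) :
    ∃ δ : ℝ, 0 < δ ∧ ∀ L : ℝ, 0 < L → δ * L ^ d ≤ cubeCount p 0 (L + 2 * C) := by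
  set l : ℝ := 1 + 2 * C with hl
  have hl0 : 0 < l := by positivity
  have hpos : ∀ x, 1 ≤ cubeCount p x l := by
    intro x
    refine le_trans ?_ (cubeCount_le_of_almostInvariant hf hC (p 0) x (L := 1) le_rfl)
    exact one_le_cubeCount hf 0 one_pos
  have hk : ∀ k : ℕ, k ^ d ≤ cubeCount p 0 (k * l) := by
    intro k
    rw [cubeCount_mul hf _ hl0]
    refine le_trans ?_ (Finset.card_nsmul_le_sum _ _ 1 fun i _ => hpos _)
    simp
  -- Every cube of side `l` contains a term, and `⌊L / l⌋ ≥ L / (2 * l)` once `L ≥ l`; for smaller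
  -- `L` one term suffices.
  refine ⟨((2 * l)⁻¹) ^ d, by positivity, fun L hL => ?_⟩
  rw [← mul_pow]
  rcases le_total L l with h | h
  · have : (1 : ℕ) ≤ cubeCount p 0 (L + 2 * C) := by
      refine le_trans ?_ (cubeCount_le_of_almostInvariant hf hC (p 0) 0 (L := L) le_rfl)
      exact one_le_cubeCount hf 0 hL
    refine le_trans (pow_le_one₀ (by positivity) ?_) (by exact_mod_cast this)
    rw [inv_mul_le_iff₀ (by positivity)]
    linarith
  · have h1 : (⌊L / l⌋₊ : ℝ) * l ≤ L + 2 * C := by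
      have := (le_div_iff₀ hl0).1 (Nat.floor_le (show 0 ≤ L / l by positivity))
      linarith
    have h2 : ((⌊L / l⌋₊ : ℝ)) ^ d ≤ cubeCount p 0 (L + 2 * C) := by
      exact_mod_cast (hk _).trans (cubeCount_mono hf 0 h1)
    refine le_trans ?_ h2
    gcongr
    have h3 : 1 ≤ ⌊L / l⌋₊ := Nat.le_floor (by rw [Nat.cast_one, le_div_iff₀ hl0]; linarith)
    have h4 := Nat.lt_floor_add_one (L / l)
    have h5 : (1 : ℝ) ≤ ⌊L / l⌋₊ := by exact_mod_cast h3
    have h6 : (2 * l)⁻¹ * L = L / l / 2 := by field_simp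
    rw [h6]
    linarith

/-- The asymptotic density of an almost invariant sequence. -/
lemma exists_density (hf : LocallyFiniteSeq p) (hC : AlmostInvariant p C) (hC0 : 0 ≤ C) :
    ∃ c : ℝ, 0 < c ∧ (∀ L : ℝ, 0 < L → c * L ^ d ≤ cubeCount p 0 (L + 2 * C)) ∧
      ∀ b : ℝ, c < b → ∃ L : ℝ, 0 < L ∧ (cubeCount p 0 (L + 2 * C) : ℝ) < b * L ^ d := by
  obtain ⟨δ, hδ, h⟩ := exists_pos_mul_pow_le_cubeCount hf hC hC0
  -- Defining the density as an infimum gives both required bounds without proving that a limit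
  -- exists.
  set S : Set ℝ := (fun L : ℝ => (cubeCount p 0 (L + 2 * C) : ℝ) / L ^ d) '' Set.Ioi 0 with hS
  have hne : S.Nonempty := ⟨_, 1, Set.mem_Ioi.2 one_pos, rfl⟩
  have hlb : ∀ s ∈ S, δ ≤ s := by
    rintro _ ⟨L, hL, rfl⟩
    exact (le_div_iff₀ (pow_pos hL d)).2 (h L hL)
  refine ⟨sInf S, hδ.trans_le (le_csInf hne hlb), fun L hL => ?_, fun b hb => ?_⟩
  · rw [← le_div_iff₀ (pow_pos hL d)]
    exact csInf_le ⟨δ, hlb⟩ ⟨L, hL, rfl⟩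
  · obtain ⟨_, ⟨L, hL, rfl⟩, hlt⟩ := exists_lt_of_csInf_lt hne hb
    exact ⟨L, hL, (div_lt_iff₀ (pow_pos hL d)).1 hlt⟩

end Count

lemma tendsto_affine_pow_div_pow (u v : ℝ) (d : ℕ) :
    Filter.Tendsto (fun R : ℕ => (u * R + v) ^ d / (R : ℝ) ^ d) Filter.atTop (nhds (u ^ d)) := by
  have h : Filter.Tendsto (fun R : ℕ => (u + v / (R : ℝ)) ^ d) Filter.atTop
      (nhds ((u + 0) ^ d)) :=
    (tendsto_const_nhds.add (tendsto_const_div_atTop_nhds_zero_nat v)).pow d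
  rw [add_zero] at h
  refine h.congr' ?_
  filter_upwards [Filter.eventually_gt_atTop 0] with R hR
  have : (R : ℝ) ≠ 0 := by positivity
  rw [← div_pow]
  congr 1
  field_simp

/-- An inequality between polynomials of degree `d` passes to the leading coefficients. -/
lemma mul_pow_le_of_eventually {s t u v u' v' : ℝ} {d : ℕ}
    (h : ∀ᶠ R : ℕ in Filter.atTop, s * (u * R + v) ^ d ≤ t * (u' * R + v') ^ d) :
    s * u ^ d ≤ t * u' ^ d := by
  refine le_of_tendsto_of_tendsto ((tendsto_affine_pow_div_pow u v d).const_mul s)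
    ((tendsto_affine_pow_div_pow u' v' d).const_mul t) ?_
  filter_upwards [h] with R hR
  rw [← mul_div_assoc, ← mul_div_assoc]
  gcongr

/-! ### Hall's condition and the matching with a lattice -/

section Matching

variable {d : ℕ} {p : ℕ → Fin d → ℝ} {C : ℝ}

/-- `α k` lies within `D` of `p n` in every coordinate. -/
def NearLattice (p : ℕ → Fin d → ℝ) (α D : ℝ) (n : ℕ) (k : Fin d → ℤ) : Prop :=
  ∀ j, |α * k j - p n j| ≤ D

lemma finite_setOf_nearLattice_right (p : ℕ → Fin d → ℝ) {α : ℝ} (hα : 0 < α) (D : ℝ) (n : ℕ) :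
    {k | NearLattice p α D n k}.Finite := by
  refine (Set.finite_Icc (fun j => ⌈(p n j - D) / α⌉) (fun j => ⌊(p n j + D) / α⌋)).subset ?_
  intro k hk
  refine ⟨fun j => ?_, fun j => ?_⟩
  · have := abs_le.1 (hk j)
    rw [Int.ceil_le, div_le_iff₀ hα]
    linarith
  · have := abs_le.1 (hk j)
    rw [Int.le_floor, le_div_iff₀ hα]
    linarith

lemma finite_setOf_nearLattice_left (hf : LocallyFiniteSeq p) (α D : ℝ) (k : Fin d → ℤ) :
    {n | NearLattice p α D n k}.Finite := by
  refine (hf (fun j => α * k j - D) (2 * D + 1)).subset ?_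
  intro n hn j
  have := abs_le.1 (hn j)
  constructor <;> linarith

/-- The `R ^ d` shifts of a cell tile a cube of side `R * α`, so summing over shifts gives
large-cube counts. -/
lemma shift_cubeCount_sum (hf : LocallyFiniteSeq p) {α : ℝ} (hα : 0 < α) (R : ℕ)
    (B : Finset (Fin d → ℤ)) :
    ∑ z : Fin d → Fin R, ∑ b ∈ B, cubeCount p (fun j => α * b j + α * ((z j : ℕ) : ℝ)) α =
      ∑ b ∈ B, cubeCount p (fun j => α * b j) (R * α) := by
  rw [Finset.sum_comm]
  exact Finset.sum_congr rfl fun b _ => (cubeCount_mul hf _ hα R).symm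

lemma card_le_sum_cubeCount (hf : LocallyFiniteSeq p) (hC : AlmostInvariant p C) {α : ℝ}
    (hα : 0 < α) (F : Finset ℕ) (B : Finset (Fin d → ℤ))
    (hB : ∀ n ∈ F, ∀ k, NearLattice p α (C + α) n k → k ∈ B) (z : Fin d → ℝ) :
    F.card ≤ ∑ b ∈ B, cubeCount p (fun j => α * b j + z j) α := by
  classical
  obtain ⟨σ, hσ⟩ := hC z
  have h1 : F.image σ ⊆ B.biUnion fun b => (hf (fun j => α * b j + z j) α).toFinset := by
    intro m hm
    obtain ⟨n, hn, rfl⟩ := Finset.mem_image.1 hm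
    -- The cell containing `p (σ n) - z` has its corner within `α` of that point, hence within `C +
    -- α` of `p n`.
    have hk := fun j => (mem_subcube_iff hα (z j) (p (σ n) j) _).2 rfl
    refine Finset.mem_biUnion.2 ⟨fun j => ⌊(p (σ n) j - z j) / α⌋, hB n hn _ fun j => ?_, ?_⟩
    · have h2 := abs_le.1 (hσ n j)
      have h3 := hk j
      rw [abs_le]
      constructor <;> linarith
    · simp only [Set.Finite.mem_toFinset, Set.mem_ofPred_eq]
      intro j
      have h3 := hk j
      constructor <;> linarith
  calc F.card = (F.image σ).card := (Finset.card_image_of_injective _ σ.injective).symm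
    _ ≤ _ := Finset.card_le_card h1
    _ ≤ _ := Finset.card_biUnion_le
    _ = _ := Finset.sum_congr rfl fun b _ => (Set.ncard_eq_toFinset_card _ (hf _ _)).symm

lemma sum_cubeCount_le_card (hf : LocallyFiniteSeq p) (hC : AlmostInvariant p C) {α : ℝ}
    (hα : 0 < α) (B : Finset (Fin d → ℤ)) (F : Finset ℕ)
    (hF : ∀ k ∈ B, ∀ n, NearLattice p α (C + α) n k → n ∈ F) (z : Fin d → ℝ) :
    ∑ b ∈ B, cubeCount p (fun j => α * b j + z j) α ≤ F.card := by
  classical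
  obtain ⟨σ, hσ⟩ := hC (-z)
  have hd : (B : Set (Fin d → ℤ)).PairwiseDisjoint
      fun b => (hf (fun j => α * b j + z j) α).toFinset := by
    intro b _ b' _ hne
    refine Finset.disjoint_left.2 fun n hn hn' => hne ?_
    simp only [Set.Finite.mem_toFinset, Set.mem_ofPred_eq] at hn hn'
    ext j
    rw [← (mem_subcube_iff hα (z j) (p n j) (b j)).1 (by simpa only [add_comm] using hn j),
      (mem_subcube_iff hα (z j) (p n j) (b' j)).1 (by simpa only [add_comm] using hn' j)]
  calc _ = ∑ b ∈ B, (hf (fun j => α * b j + z j) α).toFinset.card :=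
        Finset.sum_congr rfl fun b _ => Set.ncard_eq_toFinset_card _ (hf _ _)
    _ = _ := (Finset.card_biUnion hd).symm
    _ ≤ F.card := by
      refine Finset.card_le_card_of_injOn σ ?_ σ.injective.injOn
      intro n hn
      obtain ⟨b, hb, hn⟩ := Finset.mem_biUnion.1 hn
      simp only [Set.Finite.mem_toFinset, Set.mem_ofPred_eq] at hn
      refine hF b hb _ fun j => ?_
      have h2 := abs_le.1 (hσ n j)
      have h3 := hn j
      simp only [Pi.neg_apply] at h2
      rw [abs_le]
      constructor <;> linarith

/-- Hall's condition for matching the terms of `p` to the lattice `α ℤ^d`. -/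
lemma card_le_card_nearLattice (hf : LocallyFiniteSeq p) (hC : AlmostInvariant p C)
    {α c : ℝ} (hα : 0 < α) (hc : c * α ^ d = 1)
    (hinf : ∀ b : ℝ, c < b → ∃ L : ℝ, 0 < L ∧ (cubeCount p 0 (L + 2 * C) : ℝ) < b * L ^ d)
    (F : Finset ℕ) (B : Finset (Fin d → ℤ))
    (hB : ∀ n ∈ F, ∀ k, NearLattice p α (C + α) n k → k ∈ B) : F.card ≤ B.card := by
  have key : ∀ L : ℝ, 0 < L →
      (F.card : ℝ) * 1 ^ d ≤ (B.card * cubeCount p 0 (L + 2 * C)) * (α / L) ^ d := by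
    intro L hL
    refine mul_pow_le_of_eventually (v := 0) (v' := 1) (Filter.Eventually.of_forall fun R => ?_)
    have h1 : R ^ d * F.card ≤ ∑ b ∈ B, cubeCount p (fun j => α * b j) (R * α) := by
      rw [← shift_cubeCount_sum hf hα]
      refine le_trans ?_ (Finset.card_nsmul_le_sum _ _ F.card fun z _ =>
        card_le_sum_cubeCount hf hC hα F B hB _)
      simp
    have h2 : ((∑ b ∈ B, cubeCount p (fun j => α * b j) (R * α) : ℕ) : ℝ) ≤
        B.card * (((R * α) / L + 1) ^ d * cubeCount p 0 (L + 2 * C)) := by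
      have hT : 0 ≤ (R : ℝ) * α := by positivity
      rw [Nat.cast_sum]
      exact (Finset.sum_le_card_nsmul _ _ _ fun b _ =>
        cubeCount_le_div_pow hf hC hL hT _).trans_eq (nsmul_eq_mul _ _)
    have h3 : (R : ℝ) ^ d * F.card ≤
        ((∑ b ∈ B, cubeCount p (fun j => α * b j) (R * α) : ℕ) : ℝ) := by
      exact_mod_cast h1
    have h4 : (R : ℝ) * α / L + 1 = α / L * R + 1 := by ring
    rw [h4] at h2
    rw [one_mul, add_zero]
    linarith
  -- The infimum `c` need not be attained, so the bound is proved for `b > c` and then `b` tends to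
  -- `c`.
  have h4 : ∀ b : ℝ, c < b → (F.card : ℝ) ≤ B.card * (b * α ^ d) := by
    intro b hb
    obtain ⟨L, hL, h⟩ := hinf b hb
    have h5 := key L hL
    rw [one_pow, mul_one, div_pow] at h5
    refine h5.trans ?_
    rw [mul_assoc]
    refine mul_le_mul_of_nonneg_left ?_ (Nat.cast_nonneg _)
    rw [← mul_div_assoc, div_le_iff₀ (by positivity)]
    have := mul_le_mul_of_nonneg_right h.le (pow_pos hα d).le
    linarith
  have h6 : (F.card : ℝ) ≤ B.card * (c * α ^ d) := by
    have hcont : Filter.Tendsto (fun b : ℝ => (B.card : ℝ) * (b * α ^ d)) (nhdsWithin c (Set.Ioi c))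
        (nhds (B.card * (c * α ^ d))) :=
      Filter.Tendsto.mono_left (Continuous.tendsto (by fun_prop) c) nhdsWithin_le_nhds
    refine ge_of_tendsto hcont ?_
    filter_upwards [self_mem_nhdsWithin] with b hb using h4 b hb
  rw [hc, mul_one] at h6
  exact_mod_cast h6

/-- Hall's condition for matching the lattice `α ℤ^d` to the terms of `p`. -/
lemma card_nearLattice_le_card (hf : LocallyFiniteSeq p) (hC : AlmostInvariant p C)
    {α c : ℝ} (hα : 0 < α) (hc : c * α ^ d = 1)
    (hlow : ∀ L : ℝ, 0 < L → c * L ^ d ≤ cubeCount p 0 (L + 2 * C))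
    (B : Finset (Fin d → ℤ)) (F : Finset ℕ)
    (hF : ∀ k ∈ B, ∀ n, NearLattice p α (C + α) n k → n ∈ F) : B.card ≤ F.card := by
  have key : (B.card * c : ℝ) * α ^ d ≤ F.card * 1 ^ d := by
    -- One `2 * C` is the padding in the definition of `c`, the other the cost of moving the cube.
    refine mul_pow_le_of_eventually (v := -(4 * C)) (v' := 0) ?_
    have ht : Filter.Tendsto (fun R : ℕ => α * (R : ℝ)) Filter.atTop Filter.atTop :=
      tendsto_natCast_atTop_atTop.const_mul_atTop hα
    filter_upwards [ht.eventually_gt_atTop (4 * C)] with R hR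
    have h1 : ∑ b ∈ B, cubeCount p (fun j => α * b j) (R * α) ≤ R ^ d * F.card := by
      rw [← shift_cubeCount_sum hf hα]
      refine (Finset.sum_le_card_nsmul _ _ F.card fun z _ =>
        sum_cubeCount_le_card hf hC hα B F hF _).trans ?_
      simp
    have h2 : B.card * (c * (α * R + -(4 * C)) ^ d) ≤
        ((∑ b ∈ B, cubeCount p (fun j => α * b j) (R * α) : ℕ) : ℝ) := by
      rw [Nat.cast_sum, ← nsmul_eq_mul]
      refine Finset.card_nsmul_le_sum _ _ _ fun b _ => ?_
      refine (hlow _ (by linarith)).trans ?_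
      exact_mod_cast cubeCount_le_of_almostInvariant hf hC 0 _ (by linarith)
    have h3 : _ ≤ (R : ℝ) ^ d * F.card := h2.trans (by exact_mod_cast h1)
    calc _ = (B.card : ℝ) * (c * (α * R + -(4 * C)) ^ d) := by ring
      _ ≤ _ := h3
      _ = _ := by ring
  rw [mul_assoc, hc, one_pow, mul_one, mul_one] at key
  exact_mod_cast key

/-- A locally finite almost invariant sequence is in bijection with a lattice, up to a bounded
displacement. -/
lemma AlmostInvariant.exists_equiv_lattice (hf : LocallyFiniteSeq p) (hC : AlmostInvariant p C)
    (hC0 : 0 ≤ C) (hd : d ≠ 0) :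
    ∃ α : ℝ, 0 < α ∧ ∃ ψ : ℕ ≃ (Fin d → ℤ), ∀ n, NearLattice p α (C + α) n (ψ n) := by
  classical
  obtain ⟨c, hc, hlow, hinf⟩ := exists_density hf hC hC0
  obtain ⟨α, hα, hcα⟩ : ∃ α : ℝ, 0 < α ∧ c * α ^ d = 1 := by
    refine ⟨(c⁻¹) ^ ((d : ℝ)⁻¹), by positivity, ?_⟩
    rw [Real.rpow_inv_natCast_pow (by positivity) hd, mul_inv_cancel₀ hc.ne']
  refine ⟨α, hα, ?_⟩
  obtain ⟨f, hfi, hfm⟩ := (Finset.all_card_le_biUnion_card_iff_exists_injective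
    fun n => (finite_setOf_nearLattice_right p hα (C + α) n).toFinset).1 fun F =>
      card_le_card_nearLattice hf hC hα hcα hinf F _ fun n hn k hk =>
        Finset.mem_biUnion.2 ⟨n, hn, by simpa using hk⟩
  obtain ⟨g, hgi, hgm⟩ := (Finset.all_card_le_biUnion_card_iff_exists_injective
    fun k => (finite_setOf_nearLattice_left hf α (C + α) k).toFinset).1 fun B =>
      card_nearLattice_le_card hf hC hα hcα hlow B _ fun k hk n hn =>
        Finset.mem_biUnion.2 ⟨k, hk, by simpa using hn⟩
  simp only [Set.Finite.mem_toFinset, Set.mem_ofPred_eq] at hfm hgm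
  -- This bijection only uses pairs related by `f` or `g`, so the displacement bound survives.
  obtain ⟨h, hb, hh⟩ := Function.Embedding.schroeder_bernstein_of_rel hfi hgi
    (NearLattice p α (C + α)) hfm hgm
  exact ⟨Equiv.ofBijective h hb, hh⟩

end Matching

/-! ### Euclidean norm and coordinates -/

section Euclidean

variable {d : ℕ} {a : ℕ → EuclideanSpace ℝ (Fin d)}

lemma IsDiscreteSeq.finite_preimage (ha : IsDiscreteSeq a) {K : Set (EuclideanSpace ℝ (Fin d))}
    (hK : IsCompact K) : (a ⁻¹' K).Finite := by
  have h : (K ∩ Set.range a).Finite := by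
    by_contra hinf
    obtain ⟨x, _, hx⟩ := Set.Infinite.exists_accPt_of_subset_isCompact hinf hK
      Set.inter_subset_left
    exact ha.1 x (hx.mono (Filter.principal_mono.2 Set.inter_subset_right))
  rw [← Set.preimage_inter_range]
  exact Set.Finite.preimage' h fun x hx => ha.2 x hx.2

lemma norm_le_of_coord_le {D : ℝ} {x : EuclideanSpace ℝ (Fin d)} (h : ∀ j, |x j| ≤ D) :
    ‖x‖ ≤ √(d * D ^ 2) := by
  rw [EuclideanSpace.norm_eq]
  refine Real.sqrt_le_sqrt ?_
  refine (Finset.sum_le_card_nsmul _ _ (D ^ 2) fun j _ => ?_).trans (by simp)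
  exact pow_le_pow_left₀ (norm_nonneg _) (h j) 2

lemma IsDiscreteSeq.locallyFiniteSeq (ha : IsDiscreteSeq a) :
    LocallyFiniteSeq fun n j => a n j := by
  intro x L
  refine (ha.finite_preimage (isCompact_closedBall (WithLp.toLp 2 x) √(d * L ^ 2))).subset ?_
  intro n hn
  rw [Set.mem_preimage, mem_closedBall_iff_norm]
  refine norm_le_of_coord_le fun j => ?_
  have := hn j
  rw [PiLp.sub_apply, abs_le]
  constructor <;> linarith

/-- In `ℝ^0` one value would be taken infinitely often. This permits the `d`-th root defining `α`.
-/
lemma IsDiscreteSeq.ne_zero (ha : IsDiscreteSeq a) : d ≠ 0 := by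
  rintro rfl
  refine Set.infinite_univ (α := ℕ) ?_
  convert ha.2 (a 0) ⟨0, rfl⟩
  simp [Subsingleton.elim (a _) (a 0)]

lemma IsUniformlySpread.exists_norm_le (h : IsUniformlySpread a) :
    ∃ α : ℝ, 0 < α ∧ ∃ (ψ : ℕ ≃ (Fin d → ℤ)) (K : ℝ),
      ∀ n, ‖a n - α • latticePoint (ψ n)‖ ≤ K := by
  obtain ⟨α, hα, h⟩ := h
  obtain ⟨ψ, hψ⟩ := iInf_lt_iff.1 h
  refine ⟨α, hα, ψ, (⨆ n, edist (a n) (α • latticePoint (ψ n))).toReal, fun n => ?_⟩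
  rw [← dist_eq_norm, dist_edist]
  exact ENNReal.toReal_mono hψ.ne (le_iSup (fun n => edist (a n) (α • latticePoint (ψ n))) n)

lemma isUniformlySpread_of_norm_le {α K : ℝ} (hα : 0 < α) (ψ : ℕ ≃ (Fin d → ℤ))
    (h : ∀ n, ‖a n - α • latticePoint (ψ n)‖ ≤ K) : IsUniformlySpread a := by
  refine ⟨α, hα, iInf_lt_iff.2 ⟨ψ, lt_of_le_of_lt (iSup_le fun n => ?_)
    (ENNReal.ofReal_lt_top (r := K))⟩⟩
  rw [edist_dist, dist_eq_norm]
  exact ENNReal.ofReal_le_ofReal (h n)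

end Euclidean

theorem theorem2 (d : ℕ) (a : ℕ → EuclideanSpace ℝ (Fin d)) (ha : IsDiscreteSeq a) :
    IsUniformlySpread a ↔
      ∃ C : ℝ, ∀ z : EuclideanSpace ℝ (Fin d), ∃ σ : ℕ ≃ ℕ,
        ∀ n : ℕ, ‖a n + z - a (σ n)‖ ≤ C := by
  constructor
  · intro h
    obtain ⟨α, hα, ψ, K, hK⟩ := h.exists_norm_le
    -- The two `K` bound the distances of `a n` and `a (σ n)` from their lattice points; the middle
    -- term is the rounding error of `z`.
    refine ⟨K + √(d * α ^ 2) + K, fun z => ?_⟩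
    set m : Fin d → ℤ := fun j => ⌊z j / α⌋ with hm
    refine ⟨(ψ.trans (Equiv.addRight m)).trans ψ.symm, fun n => ?_⟩
    set n' := ((ψ.trans (Equiv.addRight m)).trans ψ.symm) n with hn'
    have e1 : ψ n' = ψ n + m := by simp [hn']
    have e2 : a n + z - a n' = (a n - α • latticePoint (ψ n)) + (z - α • latticePoint m) -
        (a n' - α • latticePoint (ψ n')) := by
      ext j
      simp [e1, latticePoint]
      ring
    have e3 : ‖z - α • latticePoint m‖ ≤ √(d * α ^ 2) := by
      refine norm_le_of_coord_le fun j => ?_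
      have := (mem_subcube_iff hα 0 (z j) ⌊z j / α⌋).2 (by simp)
      simp only [latticePoint, PiLp.sub_apply, PiLp.smul_apply, smul_eq_mul, hm]
      rw [abs_le]
      constructor <;> linarith
    rw [e2]
    exact (norm_sub_le _ _).trans
      (add_le_add ((norm_add_le _ _).trans (add_le_add (hK n) e3)) (hK n'))
  · rintro ⟨C, hC⟩
    have hC0 : 0 ≤ C := by
      obtain ⟨σ, hσ⟩ := hC 0
      exact (norm_nonneg _).trans (hσ 0)
    have hinv : AlmostInvariant (fun n j => a n j) C := by
      intro z
      obtain ⟨σ, hσ⟩ := hC (WithLp.toLp 2 z)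
      exact ⟨σ, fun n j => (PiLp.norm_apply_le (a n + WithLp.toLp 2 z - a (σ n)) j).trans (hσ n)⟩
    obtain ⟨α, hα, ψ, hψ⟩ := hinv.exists_equiv_lattice ha.locallyFiniteSeq hC0 ha.ne_zero
    refine isUniformlySpread_of_norm_le hα ψ (K := √(d * (C + α) ^ 2)) fun n => ?_
    refine norm_le_of_coord_le fun j => ?_
    have := hψ n j
    rw [abs_sub_comm] at this
    simpa [latticePoint] using this
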